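/- Let $H_3$ be the Heisenberg group $\mathbb{R}^3$ with product $(x,y,z)(x',y',z')=(x+x',\,y+y',\,z+z'+xy')$, with left-invariant coframe $\sigma=dx$, $\rho=dy$, $\zeta=x\,dy-dz$. On the $4$-manifold $M=H_3\times(0,\infty)$, with $\phi$ the coordinate on $(0,\infty)$, consider the (expanding gradient Kähler–Ricci soliton) metric \[ g=\phi\,(\sigma^2+\rho^2)+F(\phi)\,\zeta^2+\frac{1}{F(\phi)}\,d\phi^2,\qquad F(\phi)=\frac{4}{\phi}\Big(1-\phi+\frac{\phi^2}{2}-e^{-\phi}\Big). \] Then for every point $p\in M$ and every $2$-plane $\alpha\subset T_pM$ the sectional curvature of $g$ satisfies \[ -\frac23<\mathrm{Sec}(\alpha)<0 . \] Both bounds are sharp: over all points of $M$ and all tangent $2$-planes, the infimum of $\mathrm{Sec}(\alpha)$ is $-\frac23$ and the supremum is $0$. -/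

import Mathlib

open scoped ContDiff

noncomputable section

/-! ### Riemannian geometry in a global chart -/

/-- A smooth Riemannian metric on an open subset of `ℝ^ι`, given by the Gram matrix
`(g_{ij})` of the coordinate vector fields. -/
structure ChartMetric (ι : Type) [Fintype ι] [DecidableEq ι] where
  domain : Set (ι → ℝ)
  isOpen_domain : IsOpen domain
  gram : (ι → ℝ) → Matrix ι ι ℝ
  smooth : ∀ i j, ContDiffOn ℝ ∞ (fun p => gram p i j) domain
  posDef : ∀ p ∈ domain, (gram p).PosDef

/-- The partial derivative `∂_k f` at `p`. -/
def partialDeriv {ι : Type} [Fintype ι] [DecidableEq ι]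
    (f : (ι → ℝ) → ℝ) (k : ι) (p : ι → ℝ) : ℝ :=
  fderiv ℝ f p (Pi.single k 1)

namespace ChartMetric

variable {ι : Type} [Fintype ι] [DecidableEq ι]

/-- The inner product `g_p(u, v)` of tangent vectors given by their coordinate components. -/
def inner (g : ChartMetric ι) (p u v : ι → ℝ) : ℝ :=
  ∑ i, ∑ j, g.gram p i j * u i * v j

/-- The Christoffel symbol `Γ^l_{ij}` of the Levi-Civita connection. -/
def christoffel (g : ChartMetric ι) (l i j : ι) (p : ι → ℝ) : ℝ :=
  (1 / 2) * ∑ m, (g.gram p)⁻¹ l m *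
    (partialDeriv (fun q => g.gram q j m) i p
      + partialDeriv (fun q => g.gram q i m) j p
      - partialDeriv (fun q => g.gram q i j) m p)

/-- The component `R^l_{kij}` of the curvature tensor, `R(∂_i, ∂_j) ∂_k = ∑ l, R^l_{kij} ∂_l`,
with `R(X, Y) Z = ∇_X ∇_Y Z - ∇_Y ∇_X Z - ∇_[X,Y] Z`. -/
def riemann (g : ChartMetric ι) (l k i j : ι) (p : ι → ℝ) : ℝ :=
  partialDeriv (g.christoffel l j k) i p - partialDeriv (g.christoffel l i k) j p
    + ∑ m, (g.christoffel l i m p * g.christoffel m j k p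
      - g.christoffel l j m p * g.christoffel m i k p)

/-- The tangent vector `R(u, v) w` at `p`. -/
def curvature (g : ChartMetric ι) (p u v w : ι → ℝ) : ι → ℝ :=
  fun l => ∑ k, ∑ i, ∑ j, g.riemann l k i j p * u i * v j * w k

/-- The sectional curvature at `p` of the plane spanned by the (linearly independent) tangent
vectors `u`, `v`. -/
def sec (g : ChartMetric ι) (p u v : ι → ℝ) : ℝ :=
  g.inner p (g.curvature p u v v) u /
    (g.inner p u u * g.inner p v v - g.inner p u v ^ 2)

/-- The set of all values of the sectional curvature, over all points of the manifold and all
tangent planes. -/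
def secValues (g : ChartMetric ι) : Set ℝ :=
  {κ | ∃ p ∈ g.domain, ∃ u v : ι → ℝ, LinearIndependent ℝ ![u, v] ∧ κ = g.sec p u v}

end ChartMetric

/-! ### The Heisenberg soliton metric in complex dimension two

Coordinates on `M = H₃ × (0, ∞)` are `(x, y, z, φ) = (p 0, p 1, p 2, p 3)`, where `H₃` is `ℝ³`
with `(x, y, z) (x', y', z') = (x + x', y + y', z + z' + x y')`. -/

/-- `F_n(φ) = 2 (-1)^(n+1) (n+1)! φ⁻¹ (∑_{k=0}^{n+1} (-1)^k φ^k / k! - e^{-φ})`. -/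
def heisF (n : ℕ) (φ : ℝ) : ℝ :=
  2 * (-1) ^ (n + 1) * ((n + 1).factorial : ℝ) * (1 / φ) *
    ((∑ k ∈ Finset.range (n + 2), (-1) ^ k / (k.factorial : ℝ) * φ ^ k) - Real.exp (-φ))

/-- The left-invariant 1-form `σ = dx`. -/
def coframeSigma : Fin 4 → ℝ := ![1, 0, 0, 0]

/-- The left-invariant 1-form `ρ = dy`. -/
def coframeRho : Fin 4 → ℝ := ![0, 1, 0, 0]

/-- The left-invariant 1-form `ζ = x dy - dz`. -/
def coframeZeta (p : Fin 4 → ℝ) : Fin 4 → ℝ := ![0, p 0, -1, 0]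

/-- The 1-form `dφ`. -/
def coframePhi : Fin 4 → ℝ := ![0, 0, 0, 1]

/-- The Gram matrix of `φ (σ² + ρ²) + F₁(φ) ζ² + F₁(φ)⁻¹ dφ²`. -/
def heisGram (p : Fin 4 → ℝ) : Matrix (Fin 4) (Fin 4) ℝ :=
  p 3 • (Matrix.vecMulVec coframeSigma coframeSigma + Matrix.vecMulVec coframeRho coframeRho)
    + heisF 1 (p 3) • Matrix.vecMulVec (coframeZeta p) (coframeZeta p)
    + (1 / heisF 1 (p 3)) • Matrix.vecMulVec coframePhi coframePhi

theorem heisF_one_pos {t : ℝ} (ht : 0 < t) : 0 < heisF 1 t := by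
  have h1 : 1 + t + t ^ 2 / 2 ≤ Real.exp t := Real.quadratic_le_exp_of_nonneg ht.le
  have h2 : Real.exp t * Real.exp (-t) = 1 := by rw [← Real.exp_add]; simp
  have h3 : 0 < Real.exp (-t) := Real.exp_pos _
  have h4 : 0 < 1 - t + t ^ 2 / 2 := by nlinarith [sq_nonneg (t - 1)]
  have h5 : Real.exp (-t) < 1 - t + t ^ 2 / 2 := by
    have h6 : (1 + t + t ^ 2 / 2) * Real.exp (-t) ≤ 1 := by
      refine le_trans ?_ h2.le
      exact mul_le_mul_of_nonneg_right h1 h3.le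
    have h7 : 1 < (1 + t + t ^ 2 / 2) * (1 - t + t ^ 2 / 2) := by
      nlinarith [pow_pos ht 4]
    have h8 : 0 < 1 + t + t ^ 2 / 2 := by positivity
    exact lt_of_mul_lt_mul_left (h6.trans_lt h7) h8.le
  have h9 : heisF 1 t = 4 * (1 / t) * ((1 - t + t ^ 2 / 2) - Real.exp (-t)) := by
    simp [heisF, Finset.sum_range_succ, Nat.factorial]
    ring
  rw [h9]
  have : 0 < (1 - t + t ^ 2 / 2) - Real.exp (-t) := by linarith
  positivity

theorem heisF_contDiffOn (n : ℕ) : ContDiffOn ℝ ∞ (heisF n) (Set.Ioi 0) := by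
  unfold heisF
  refine ContDiffOn.mul (ContDiffOn.mul contDiffOn_const ?_) ?_
  · exact contDiffOn_const.div contDiffOn_id fun t ht => ne_of_gt ht
  · fun_prop

theorem heisGram_smooth (i j : Fin 4) :
    ContDiffOn ℝ ∞ (fun p => heisGram p i j) {p : Fin 4 → ℝ | 0 < p 3} := by
  have hF : ContDiffOn ℝ ∞ (fun p : Fin 4 → ℝ => heisF 1 (p 3)) {p | 0 < p 3} :=
    (heisF_contDiffOn 1).comp (by fun_prop) fun p hp => hp
  have hF' : ContDiffOn ℝ ∞ (fun p : Fin 4 → ℝ => 1 / heisF 1 (p 3)) {p | 0 < p 3} :=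
    contDiffOn_const.div hF fun p hp => (heisF_one_pos hp).ne'
  have hz : ∀ k, ContDiffOn ℝ ∞ (fun p : Fin 4 → ℝ => coframeZeta p k) {p | 0 < p 3} := by
    intro k
    fin_cases k <;> simp [coframeZeta] <;> fun_prop
  have h3 : ContDiffOn ℝ ∞ (fun p : Fin 4 → ℝ => p 3) {p | 0 < p 3} := by fun_prop
  simp only [heisGram, Matrix.add_apply, Matrix.smul_apply, Matrix.vecMulVec_apply, smul_eq_mul]
  exact ((h3.mul contDiffOn_const).add (hF.mul ((hz i).mul (hz j)))).add (hF'.mul contDiffOn_const)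

theorem heisGram_posDef {p : Fin 4 → ℝ} (hp : 0 < p 3) : (heisGram p).PosDef := by
  have hF := heisF_one_pos hp
  refine Matrix.PosDef.of_dotProduct_mulVec_pos ?_ ?_
  · ext i j
    simp [heisGram, Matrix.vecMulVec_apply, mul_comm]
  · intro v hv
    have key : star v ⬝ᵥ (heisGram p).mulVec v = p 3 * (v 0 ^ 2 + v 1 ^ 2)
        + heisF 1 (p 3) * (p 0 * v 1 - v 2) ^ 2 + (1 / heisF 1 (p 3)) * v 3 ^ 2 := by
      simp [heisGram, Matrix.mulVec, dotProduct, Fin.sum_univ_four,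
        coframeSigma, coframeRho, coframeZeta, coframePhi]
      ring
    rw [key]
    have e1 : 0 ≤ p 3 * (v 0 ^ 2 + v 1 ^ 2) := by positivity
    have e2 : 0 ≤ heisF 1 (p 3) * (p 0 * v 1 - v 2) ^ 2 := by positivity
    have e3 : 0 ≤ (1 / heisF 1 (p 3)) * v 3 ^ 2 := by positivity
    by_contra hle
    have f1 : p 3 * (v 0 ^ 2 + v 1 ^ 2) = 0 := by linarith
    have f2 : heisF 1 (p 3) * (p 0 * v 1 - v 2) ^ 2 = 0 := by linarith
    have f3 : (1 / heisF 1 (p 3)) * v 3 ^ 2 = 0 := by linarith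
    have g1 : v 0 ^ 2 + v 1 ^ 2 = 0 := (mul_eq_zero.1 f1).resolve_left hp.ne'
    have v0 : v 0 = 0 := by nlinarith [sq_nonneg (v 0), sq_nonneg (v 1)]
    have v1 : v 1 = 0 := by nlinarith [sq_nonneg (v 0), sq_nonneg (v 1)]
    have g2 : (p 0 * v 1 - v 2) ^ 2 = 0 := (mul_eq_zero.1 f2).resolve_left hF.ne'
    have v2 : v 2 = 0 := by
      have := pow_eq_zero_iff (two_ne_zero) |>.1 g2
      rw [v1] at this; linarith
    have v3 : v 3 = 0 := by
      have := (mul_eq_zero.1 f3).resolve_left (one_div_pos.2 hF).ne'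
      exact pow_eq_zero_iff (two_ne_zero) |>.1 this
    apply hv
    ext i
    fin_cases i <;> simp [v0, v1, v2, v3]

/-- The Heisenberg expanding gradient Kähler-Ricci soliton metric in complex dimension two, on
`M = H₃ × (0, ∞) = {(x, y, z, φ) | φ > 0}`. -/
def heisenbergSoliton : ChartMetric (Fin 4) where
  domain := {p | 0 < p 3}
  isOpen_domain := isOpen_lt continuous_const (continuous_apply 3)
  gram := heisGram
  smooth := heisGram_smooth
  posDef := fun _ hp => heisGram_posDef hp

end

/-! For a pair `u, v` put `a = (ζ ∧ dφ)(u, v)`, `b = φ (σ ∧ ρ)(u, v)` and `M = φ F (c² + d²)`, where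
`c, d` are the values of `σ ∧ ζ - ρ ∧ dφ / F` and `ρ ∧ ζ + σ ∧ dφ / F`. A direct computation of the
Levi-Civita connection expresses the curvature through these four forms alone, with coefficients
built from `F`, `F'`, `F''`.

Those coefficients are moments of `e^{-φ s}` on `[0, 1]`, so that `Sec = -(∫ q(s) e^{-φ s} ds) / (a²
+ b² + M + 2ab)` with `q(s) = 2 (s a - (1 - s) b)² + s (1 - s) M` (`integral_curvature`,
`sec_eq_integral`). Since `q ≥ 0` on `[0, 1]` and `q` is positive somewhere, `Sec < 0`. Replacing
the exponential by `1` bounds the integral by `∫ q`, which is at most `2/3` of the denominator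
because `M + 4ab ≥ 0`.

For sharpness, the plane of `∂_x, ∂_y` at `x = 0` has curvature `-F/φ²`, which tends to `-2/3` as `φ
→ 0` and to `0` as `φ → ∞`. -/

/-! ### Derivatives of `F` -/

/-- The derivative of `heisF 1`. -/
noncomputable def heisFDeriv (t : ℝ) : ℝ :=
  -4 / t ^ 2 * (1 - t + t ^ 2 / 2 - Real.exp (-t)) + 4 / t * (-1 + t + Real.exp (-t))

/-- The second derivative of `heisF 1`. -/
noncomputable def heisFDeriv₂ (t : ℝ) : ℝ :=
  8 / t ^ 3 * (1 - t + t ^ 2 / 2 - Real.exp (-t)) - 8 / t ^ 2 * (-1 + t + Real.exp (-t))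
    + 4 / t * (1 - Real.exp (-t))

theorem heisF_one_eq (t : ℝ) :
    heisF 1 t = 4 / t * (1 - t + t ^ 2 / 2 - Real.exp (-t)) := by
  simp [heisF, Finset.sum_range_succ, Nat.factorial]
  ring

theorem hasDerivAt_exp_neg (t : ℝ) :
    HasDerivAt (fun s : ℝ => Real.exp (-s)) (-Real.exp (-t)) t := by
  simpa using (hasDerivAt_neg t).exp

theorem hasDerivAt_heisF {t : ℝ} (ht : t ≠ 0) : HasDerivAt (heisF 1) (heisFDeriv t) t := by
  rw [funext heisF_one_eq]
  have h1 : HasDerivAt (fun s : ℝ => 4 / s) (-4 / t ^ 2) t := by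
    refine HasDerivAt.congr_deriv ((hasDerivAt_const t (4 : ℝ)).fun_div (hasDerivAt_id' t) ht) ?_
    ring
  have h2 : HasDerivAt (fun s : ℝ => 1 - s + s ^ 2 / 2 - Real.exp (-s))
      (-1 + t + Real.exp (-t)) t := by
    refine HasDerivAt.congr_deriv ((((hasDerivAt_id' t).const_sub 1).fun_add
      ((hasDerivAt_pow 2 t).div_const 2)).fun_sub (hasDerivAt_exp_neg t)) ?_
    push_cast
    ring
  exact h1.fun_mul h2

theorem hasDerivAt_heisFDeriv {t : ℝ} (ht : t ≠ 0) :
    HasDerivAt heisFDeriv (heisFDeriv₂ t) t := by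
  have h1 : HasDerivAt (fun s : ℝ => 4 / s) (-4 / t ^ 2) t := by
    refine HasDerivAt.congr_deriv ((hasDerivAt_const t (4 : ℝ)).fun_div (hasDerivAt_id' t) ht) ?_
    ring
  have h1' : HasDerivAt (fun s : ℝ => -4 / s ^ 2) (8 / t ^ 3) t := by
    refine HasDerivAt.congr_deriv ((hasDerivAt_const t (-4 : ℝ)).fun_div (hasDerivAt_pow 2 t) (pow_ne_zero 2 ht)) ?_
    field_simp
    push_cast
    ring
  have h2 : HasDerivAt (fun s : ℝ => 1 - s + s ^ 2 / 2 - Real.exp (-s))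
      (-1 + t + Real.exp (-t)) t := by
    refine HasDerivAt.congr_deriv ((((hasDerivAt_id' t).const_sub 1).fun_add
      ((hasDerivAt_pow 2 t).div_const 2)).fun_sub (hasDerivAt_exp_neg t)) ?_
    push_cast
    ring
  have h3 : HasDerivAt (fun s : ℝ => -1 + s + Real.exp (-s)) (1 - Real.exp (-t)) t := by
    refine HasDerivAt.congr_deriv (((hasDerivAt_id' t).const_add (-1)).fun_add (hasDerivAt_exp_neg t)) ?_
    ring
  refine HasDerivAt.congr_deriv ((h1'.fun_mul h2).fun_add (h1.fun_mul h3)) ?_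
  unfold heisFDeriv₂
  ring

/-! ### Partial derivatives -/

section partialDeriv

variable {ι : Type} [Fintype ι] [DecidableEq ι] {f g : (ι → ℝ) → ℝ} {p : ι → ℝ}

theorem partialDeriv_congr (h : f =ᶠ[nhds p] g) (k : ι) :
    partialDeriv f k p = partialDeriv g k p := by
  rw [partialDeriv, partialDeriv, h.fderiv_eq]

end partialDeriv

/-- Partial derivatives of a function which is quadratic in the first coordinate, with
coefficients depending on the last one. -/
theorem partialDeriv_quadratic {a b c : ℝ → ℝ} {a' b' c' : ℝ} {p : Fin 4 → ℝ}
    (ha : HasDerivAt a a' (p 3)) (hb : HasDerivAt b b' (p 3)) (hc : HasDerivAt c c' (p 3))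
    (k : Fin 4) :
    partialDeriv (fun q => a (q 3) + b (q 3) * q 0 + c (q 3) * q 0 ^ 2) k p
      = ![b (p 3) + 2 * c (p 3) * p 0, 0, 0, a' + b' * p 0 + c' * p 0 ^ 2] k := by
  have h0 : HasFDerivAt (fun q : Fin 4 → ℝ => q 0)
    (ContinuousLinearMap.proj (R := ℝ) (φ := fun _ : Fin 4 => ℝ) 0) p := hasFDerivAt_apply 0 p
  have h3 : HasFDerivAt (fun q : Fin 4 → ℝ => q 3)
    (ContinuousLinearMap.proj (R := ℝ) (φ := fun _ : Fin 4 => ℝ) 3) p := hasFDerivAt_apply 3 p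
  have key := ((ha.comp_hasFDerivAt p h3).fun_add ((hb.comp_hasFDerivAt p h3).fun_mul h0)).fun_add
    ((hc.comp_hasFDerivAt p h3).fun_mul (h0.pow 2))
  have : partialDeriv (fun q => a (q 3) + b (q 3) * q 0 + c (q 3) * q 0 ^ 2) k p = _ :=
    congrArg (fun L : (Fin 4 → ℝ) →L[ℝ] ℝ => L (Pi.single k 1)) key.fderiv
  rw [this]
  fin_cases k <;> simp <;> ring

/-! ### The Levi-Civita connection of the soliton -/

/-- The Christoffel symbols, as polynomials in `x`, `A = 1 / (2φ)`, `B = F / (2φ)`,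
`E = F' / (2F)`, `H = F F' / 2` and `J = F / 2`: coefficients of `1`, `x`, `x²`. -/
noncomputable def heisChristoffelCoeff (o A B E H J : ℝ) : Fin 4 → Fin 4 → Fin 4 → Fin 3 → ℝ :=
  ![![![0, 0, 0, ![A, 0, 0]],
      ![0, ![0, -2 * B, 0], ![B, 0, 0], 0],
      ![0, ![B, 0, 0], 0, 0],
      ![![A, 0, 0], 0, 0, 0]],
    ![![0, ![0, B, 0], ![-B, 0, 0], 0],
      ![![0, B, 0], 0, 0, ![A, 0, 0]],
      ![![-B, 0, 0], 0, 0, 0],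
      ![0, ![A, 0, 0], 0, 0]],
    ![![0, ![-o / 2, 0, B], ![0, -B, 0], 0],
      ![![-o / 2, 0, B], 0, 0, ![0, A - E, 0]],
      ![![0, -B, 0], 0, 0, ![E, 0, 0]],
      ![0, ![0, A - E, 0], ![E, 0, 0], 0]],
    ![![![-J, 0, 0], 0, 0, 0],
      ![0, ![-J, 0, -H], ![0, H, 0], 0],
      ![0, ![0, H, 0], ![-H, 0, 0], 0],
      ![0, 0, 0, ![-E, 0, 0]]]]

/-- Every entry of the table is linear in `(o, A, B, E, H, J)`, so it is differentiated by
differentiating the arguments. The slot `o` carries the constant `-1/2` of `Γ^z_{xy}`: it is `1` in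
the symbols and `0` in their derivatives. -/
theorem hasDerivAt_heisChristoffelCoeff {A B E H J : ℝ → ℝ} {A' B' E' H' J' t : ℝ}
    (hA : HasDerivAt A A' t) (hB : HasDerivAt B B' t) (hE : HasDerivAt E E' t)
    (hH : HasDerivAt H H' t) (hJ : HasDerivAt J J' t) (l i j : Fin 4) (n : Fin 3) :
    HasDerivAt (fun s => heisChristoffelCoeff 1 (A s) (B s) (E s) (H s) (J s) l i j n)
      (heisChristoffelCoeff 0 A' B' E' H' J' l i j n) t := by
  have h0 := hasDerivAt_const t (0 : ℝ)
  have h2 : HasDerivAt (fun _ : ℝ => (-1 / 2 : ℝ)) (-0 / 2) t := by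
    simpa using hasDerivAt_const t (-1 / 2 : ℝ)
  fin_cases l <;> fin_cases i <;> fin_cases j <;> fin_cases n <;>
  first
  | exact h0
  | exact h2
  | exact hA
  | exact hB
  | exact hE
  | exact hB.fun_neg
  | exact hE.fun_neg
  | exact hH
  | exact hH.fun_neg
  | exact hJ.fun_neg
  | exact hB.const_mul (-2)
  | exact hA.fun_sub hE

/-- The inverse of the Gram matrix. -/
noncomputable def heisGramInv (p : Fin 4 → ℝ) : Matrix (Fin 4) (Fin 4) ℝ :=
  !![1 / p 3, 0, 0, 0;
    0, 1 / p 3, p 0 / p 3, 0;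
    0, p 0 / p 3, 1 / heisF 1 (p 3) + p 0 ^ 2 / p 3, 0;
    0, 0, 0, heisF 1 (p 3)]

theorem heisGram_eq (p : Fin 4 → ℝ) : heisGram p =
    !![p 3, 0, 0, 0;
      0, p 3 + heisF 1 (p 3) * p 0 ^ 2, -heisF 1 (p 3) * p 0, 0;
      0, -heisF 1 (p 3) * p 0, heisF 1 (p 3), 0;
      0, 0, 0, 1 / heisF 1 (p 3)] := by
  ext i j
  fin_cases i <;> fin_cases j <;>
    simp [heisGram, coframeSigma, coframeRho, coframeZeta, coframePhi]
  ring_nf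
  simp

theorem heisGram_inv {p : Fin 4 → ℝ} (hp : 0 < p 3) : (heisGram p)⁻¹ = heisGramInv p := by
  have hF := (heisF_one_pos hp).ne'
  have ht := hp.ne'
  apply Matrix.inv_eq_right_inv
  rw [heisGram_eq, heisGramInv]
  ext i j
  fin_cases i <;> fin_cases j <;> simp [Matrix.mul_apply, Fin.sum_univ_four] <;>
    field_simp <;> ring

/-- The coefficients of `1`, `x`, `x²` in the entries of the Gram matrix, as functions of `φ`,
in terms of `t = φ`, `f = F` and `e = 1 / F`. -/
noncomputable def heisGramCoeff (t f e : ℝ) : Fin 4 → Fin 4 → Fin 3 → ℝ :=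
  ![![![t, 0, 0], 0, 0, 0],
    ![0, ![t, 0, f], ![0, -f, 0], 0],
    ![0, ![0, -f, 0], ![f, 0, 0], 0],
    ![0, 0, 0, ![e, 0, 0]]]

theorem heisGram_apply (p : Fin 4 → ℝ) (i j : Fin 4) : heisGram p i j =
    heisGramCoeff (p 3) (heisF 1 (p 3)) (1 / heisF 1 (p 3)) i j 0
      + heisGramCoeff (p 3) (heisF 1 (p 3)) (1 / heisF 1 (p 3)) i j 1 * p 0
      + heisGramCoeff (p 3) (heisF 1 (p 3)) (1 / heisF 1 (p 3)) i j 2 * p 0 ^ 2 := by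
  rw [heisGram_eq]
  fin_cases i <;> fin_cases j <;> simp [heisGramCoeff]

theorem partialDeriv_heisGram {p : Fin 4 → ℝ} (hp : 0 < p 3) (i j k : Fin 4) :
    partialDeriv (fun q => heisGram q i j) k p =
      ![heisGramCoeff (p 3) (heisF 1 (p 3)) (1 / heisF 1 (p 3)) i j 1
          + 2 * heisGramCoeff (p 3) (heisF 1 (p 3)) (1 / heisF 1 (p 3)) i j 2 * p 0, 0, 0,
        heisGramCoeff 1 (heisFDeriv (p 3)) (-heisFDeriv (p 3) / heisF 1 (p 3) ^ 2) i j 0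
          + heisGramCoeff 1 (heisFDeriv (p 3)) (-heisFDeriv (p 3) / heisF 1 (p 3) ^ 2) i j 1 * p 0
          + heisGramCoeff 1 (heisFDeriv (p 3)) (-heisFDeriv (p 3) / heisF 1 (p 3) ^ 2) i j 2
            * p 0 ^ 2] k := by
  have hF := (heisF_one_pos hp).ne'
  have h1 := hasDerivAt_id' (p 3)
  have h2 := hasDerivAt_heisF hp.ne'
  have h3 : HasDerivAt (fun s => 1 / heisF 1 s) (-heisFDeriv (p 3) / heisF 1 (p 3) ^ 2) (p 3) := by
    simpa using h2.fun_inv hF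
  have h0 := hasDerivAt_const (p 3) (0 : ℝ)
  have key : ∀ n, HasDerivAt (fun s => heisGramCoeff s (heisF 1 s) (1 / heisF 1 s) i j n)
      (heisGramCoeff 1 (heisFDeriv (p 3)) (-heisFDeriv (p 3) / heisF 1 (p 3) ^ 2) i j n)
      (p 3) := by
    intro n
    fin_cases i <;> fin_cases j <;> fin_cases n <;>
    first
    | exact h0
    | exact h1
    | exact h2
    | exact h2.fun_neg
    | exact h3
  simp only [heisGram_apply]
  exact partialDeriv_quadratic (key 0) (key 1) (key 2) k

/-- The Christoffel symbols of the soliton. -/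
noncomputable def heisChristoffel (l i j : Fin 4) (n : Fin 3) (t : ℝ) : ℝ :=
  heisChristoffelCoeff 1 (1 / (2 * t)) (heisF 1 t / (2 * t)) (heisFDeriv t / (2 * heisF 1 t))
    (heisF 1 t * heisFDeriv t / 2) (heisF 1 t / 2) l i j n

/-- The derivatives of the coefficients of the Christoffel symbols of the soliton. -/
noncomputable def heisChristoffelDeriv (l i j : Fin 4) (n : Fin 3) (t : ℝ) : ℝ :=
  heisChristoffelCoeff 0 (-1 / (2 * t ^ 2)) (heisFDeriv t / (2 * t) - heisF 1 t / (2 * t ^ 2))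
    (heisFDeriv₂ t / (2 * heisF 1 t) - heisFDeriv t ^ 2 / (2 * heisF 1 t ^ 2))
    (heisFDeriv t ^ 2 / 2 + heisF 1 t * heisFDeriv₂ t / 2) (heisFDeriv t / 2) l i j n

theorem hasDerivAt_heisChristoffel {t : ℝ} (ht : 0 < t) (l i j : Fin 4) (n : Fin 3) :
    HasDerivAt (heisChristoffel l i j n) (heisChristoffelDeriv l i j n t) t := by
  have hF := (heisF_one_pos ht).ne'
  have ht' := ht.ne'
  have h1 := hasDerivAt_heisF ht'
  have h2 := hasDerivAt_heisFDeriv ht'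
  have h2t : HasDerivAt (fun s : ℝ => 2 * s) (2 * 1) t := (hasDerivAt_id' t).const_mul 2
  have hne : 2 * t ≠ 0 := by positivity
  refine hasDerivAt_heisChristoffelCoeff ?_ ?_ ?_ ?_ ?_ l i j n
  · refine HasDerivAt.congr_deriv ((hasDerivAt_const t (1 : ℝ)).fun_div h2t hne) ?_
    field_simp
    ring
  · refine HasDerivAt.congr_deriv (h1.fun_div h2t hne) ?_
    field_simp
  · refine HasDerivAt.congr_deriv (h2.fun_div (h1.const_mul 2) (mul_ne_zero two_ne_zero hF)) ?_
    field_simp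
  · refine HasDerivAt.congr_deriv ((h1.fun_mul h2).div_const 2) ?_
    ring
  · exact h1.div_const 2

theorem christoffel_heisenbergSoliton {p : Fin 4 → ℝ} (hp : 0 < p 3) (l i j : Fin 4) :
    heisenbergSoliton.christoffel l i j p = heisChristoffel l i j 0 (p 3)
      + heisChristoffel l i j 1 (p 3) * p 0 + heisChristoffel l i j 2 (p 3) * p 0 ^ 2 := by
  have hF := (heisF_one_pos hp).ne'
  have ht := hp.ne'
  have hg : heisenbergSoliton.gram = heisGram := rfl
  simp only [ChartMetric.christoffel, hg, partialDeriv_heisGram hp, heisGram_inv hp,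
    Fin.sum_univ_four]
  fin_cases l <;> fin_cases i <;> fin_cases j <;>
    simp [heisGramInv, heisGramCoeff, heisChristoffel, heisChristoffelCoeff] <;> field_simp <;> ring

theorem partialDeriv_christoffel {p : Fin 4 → ℝ} (hp : 0 < p 3) (l i j k : Fin 4) :
    partialDeriv (heisenbergSoliton.christoffel l i j) k p =
      ![heisChristoffel l i j 1 (p 3) + 2 * heisChristoffel l i j 2 (p 3) * p 0, 0, 0,
        heisChristoffelDeriv l i j 0 (p 3) + heisChristoffelDeriv l i j 1 (p 3) * p 0
          + heisChristoffelDeriv l i j 2 (p 3) * p 0 ^ 2] k := by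
  have hmem : {q : Fin 4 → ℝ | 0 < q 3} ∈ nhds p := heisenbergSoliton.isOpen_domain.mem_nhds hp
  have h : heisenbergSoliton.christoffel l i j =ᶠ[nhds p] fun q => heisChristoffel l i j 0 (q 3)
      + heisChristoffel l i j 1 (q 3) * q 0 + heisChristoffel l i j 2 (q 3) * q 0 ^ 2 := by
    filter_upwards [hmem] with q hq
    exact christoffel_heisenbergSoliton hq l i j
  rw [partialDeriv_congr h k]
  exact partialDeriv_quadratic (hasDerivAt_heisChristoffel hp l i j 0)
    (hasDerivAt_heisChristoffel hp l i j 1) (hasDerivAt_heisChristoffel hp l i j 2) k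

/-! ### The curvature tensor of the soliton -/

/-- The `2`-form `α ∧ β` as an antisymmetric matrix. -/
def wedgeMatrix (α β : Fin 4 → ℝ) (i j : Fin 4) : ℝ := α i * β j - α j * β i

theorem sum_wedgeMatrix (α β u v : Fin 4 → ℝ) :
    ∑ i, ∑ j, wedgeMatrix α β i j * u i * v j
      = (∑ i, α i * u i) * (∑ i, β i * v i) - (∑ i, α i * v i) * ∑ i, β i * u i := by
  simp only [wedgeMatrix, Fin.sum_univ_four]
  ring

/-- The form `ζ ∧ dφ`. -/
def heisFormA (p : Fin 4 → ℝ) : Fin 4 → Fin 4 → ℝ := wedgeMatrix (coframeZeta p) coframePhi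

/-- The form `φ σ ∧ ρ`. -/
def heisFormB (p : Fin 4 → ℝ) (i j : Fin 4) : ℝ := p 3 * wedgeMatrix coframeSigma coframeRho i j

/-- The form `σ ∧ ζ - ρ ∧ dφ / F`. -/
noncomputable def heisFormC (p : Fin 4 → ℝ) (i j : Fin 4) : ℝ :=
  wedgeMatrix coframeSigma (coframeZeta p) i j
    - wedgeMatrix coframeRho coframePhi i j / heisF 1 (p 3)

/-- The form `ρ ∧ ζ + σ ∧ dφ / F`. -/
noncomputable def heisFormD (p : Fin 4 → ℝ) (i j : Fin 4) : ℝ :=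
  wedgeMatrix coframeRho (coframeZeta p) i j
    + wedgeMatrix coframeSigma coframePhi i j / heisF 1 (p 3)

/-- The curvature tensor of the soliton with all indices lowered. -/
noncomputable def heisCurvature (p : Fin 4 → ℝ) (l k i j : Fin 4) : ℝ :=
  -heisFDeriv₂ (p 3) / 2 * (heisFormA p l k * heisFormA p i j)
    - heisF 1 (p 3) / p 3 ^ 2 * (heisFormB p l k * heisFormB p i j)
    + (heisF 1 (p 3) - p 3 * heisFDeriv (p 3)) / (4 * p 3 ^ 2) *
      (-2 * (heisFormA p l k * heisFormB p i j + heisFormB p l k * heisFormA p i j)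
        + p 3 * heisF 1 (p 3) *
          (heisFormC p l k * heisFormC p i j + heisFormD p l k * heisFormD p i j))

theorem ChartMetric.riemann_swap {ι : Type} [Fintype ι] [DecidableEq ι] (g : ChartMetric ι)
    (l k i j : ι) (p : ι → ℝ) : g.riemann l k i j p = -g.riemann l k j i p := by
  simp only [riemann, Finset.sum_sub_distrib]
  ring

theorem heisCurvature_swap (p : Fin 4 → ℝ) (l k i j : Fin 4) :
    heisCurvature p l k i j = -heisCurvature p l k j i := by
  simp only [heisCurvature, heisFormA, heisFormB, heisFormC, heisFormD, wedgeMatrix]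
  ring

-- The metric is Kähler with Kähler form `φ σ ∧ ρ - ζ ∧ dφ`, so only products of the four
-- `J`-invariant forms A, B, C, D can occur. The coefficients are checked component by component;
-- antisymmetry in `i, j` leaves only `i < j`.
set_option maxHeartbeats 4000000 in
theorem lowered_riemann_of_lt {p : Fin 4 → ℝ} (hp : 0 < p 3) (l k i j : Fin 4) (hij : i < j) :
    ∑ m, heisenbergSoliton.gram p m l * heisenbergSoliton.riemann m k i j p
      = heisCurvature p l k i j := by
  have hF := (heisF_one_pos hp).ne'
  have ht := hp.ne'
  have hg : heisenbergSoliton.gram = heisGram := rfl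
  simp only [ChartMetric.riemann, hg, partialDeriv_christoffel hp, christoffel_heisenbergSoliton hp,
    Fin.sum_univ_four, heisGram_eq]
  fin_cases i <;> fin_cases j <;> first | exact absurd hij (by decide) | skip
  all_goals fin_cases l <;> fin_cases k <;>
    simp [heisChristoffel, heisChristoffelDeriv, heisChristoffelCoeff, heisCurvature, heisFormA,
      heisFormB, heisFormC, heisFormD, wedgeMatrix, coframeSigma, coframeRho, coframeZeta,
      coframePhi, hF, ht] <;>
    field_simp <;> ring

/-! ### Moments of the exponential -/

theorem integral_quadratic_mul_exp {t : ℝ} (ht : 0 < t) (c₀ c₁ c₂ : ℝ) :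
    ∫ s in (0 : ℝ)..1, (c₀ + c₁ * s + c₂ * s ^ 2) * Real.exp (-(t * s)) =
      (c₀ / t + c₁ / t ^ 2 + 2 * c₂ / t ^ 3)
        - (c₀ / t + c₁ * (1 / t + 1 / t ^ 2) + c₂ * (1 / t + 2 / t ^ 2 + 2 / t ^ 3))
          * Real.exp (-t) := by
  have h : ∀ s ∈ Set.uIcc (0 : ℝ) 1, HasDerivAt (fun s => -((c₀ / t + c₁ * (s / t + 1 / t ^ 2)
      + c₂ * (s ^ 2 / t + 2 * s / t ^ 2 + 2 / t ^ 3)) * Real.exp (-(t * s))))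
      ((c₀ + c₁ * s + c₂ * s ^ 2) * Real.exp (-(t * s))) s := by
    intro s _
    have h1 : HasDerivAt (fun s : ℝ => Real.exp (-(t * s)))
        (Real.exp (-(t * s)) * -(t * 1)) s := ((hasDerivAt_id' s).const_mul t).fun_neg.exp
    have h2 : HasDerivAt (fun s : ℝ => c₁ * (s / t + 1 / t ^ 2)) (c₁ * (1 / t)) s :=
      (((hasDerivAt_id' s).div_const t).add_const _).const_mul c₁
    have h3 : HasDerivAt (fun s : ℝ => c₂ * (s ^ 2 / t + 2 * s / t ^ 2 + 2 / t ^ 3))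
        (c₂ * ((2 : ℕ) * s ^ (2 - 1) / t + 2 * 1 / t ^ 2)) s :=
      ((((hasDerivAt_pow 2 s).div_const t).fun_add
        (((hasDerivAt_id' s).const_mul 2).div_const _)).add_const _).const_mul c₂
    refine HasDerivAt.congr_deriv ((((h2.const_add (c₀ / t)).fun_add h3).fun_mul h1).fun_neg) ?_
    field_simp
    push_cast
    ring
  rw [intervalIntegral.integral_eq_sub_of_hasDerivAt h
    (Continuous.intervalIntegrable (by fun_prop) _ _)]
  simp
  ring

/-! ### The quadratic polynomial whose moments against `e^{-φ s}` compute the curvature -/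

/-- At `s = 1` the value is `2a²`; if `a = 0`, the value at `s = 1/2` is `b²/2 + M/4`. The point `s
= 0` is excluded because strictness of `e^{-ts} < 1` is needed there later. -/
theorem quadratic_pos {a b M : ℝ} (h : 0 < a ^ 2 + b ^ 2 + M + 2 * a * b) :
    ∃ s ∈ Set.Ioc (0 : ℝ) 1, 0 < 2 * (s * a - (1 - s) * b) ^ 2 + s * (1 - s) * M := by
  rcases eq_or_ne a 0 with rfl | ha
  · refine ⟨1 / 2, by norm_num, ?_⟩
    nlinarith
  · refine ⟨1, by norm_num, ?_⟩
    have := pow_pos (abs_pos.2 ha) 2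
    rw [sq_abs] at this
    linarith

theorem quadratic_nonneg (a b : ℝ) {M s : ℝ} (hM : 0 ≤ M) (hs : s ∈ Set.Icc (0 : ℝ) 1) :
    0 ≤ 2 * (s * a - (1 - s) * b) ^ 2 + s * (1 - s) * M := by
  have : 0 ≤ s * (1 - s) * M := mul_nonneg (mul_nonneg hs.1 (by linarith [hs.2])) hM
  positivity

theorem integral_curvature_pos {a b M t : ℝ} (hM : 0 ≤ M)
    (h : 0 < a ^ 2 + b ^ 2 + M + 2 * a * b) :
    0 < ∫ s in (0 : ℝ)..1,
      (2 * (s * a - (1 - s) * b) ^ 2 + s * (1 - s) * M) * Real.exp (-(t * s)) := by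
  obtain ⟨s, hs, hpos⟩ := quadratic_pos h
  refine intervalIntegral.integral_pos one_pos (by fun_prop) ?_
    ⟨s, Set.Ioc_subset_Icc_self hs, by positivity⟩
  intro r hr
  exact mul_nonneg (quadratic_nonneg a b hM (Set.Ioc_subset_Icc_self hr)) (Real.exp_pos _).le

theorem integral_curvature_lt {a b M t : ℝ} (ht : 0 < t) (hM : 0 ≤ M)
    (h4 : 0 ≤ M + 4 * a * b) (h : 0 < a ^ 2 + b ^ 2 + M + 2 * a * b) :
    ∫ s in (0 : ℝ)..1, (2 * (s * a - (1 - s) * b) ^ 2 + s * (1 - s) * M) * Real.exp (-(t * s))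
      < 2 / 3 * (a ^ 2 + b ^ 2 + M + 2 * a * b) := by
  have hint : ∫ s in (0 : ℝ)..1, (2 * (s * a - (1 - s) * b) ^ 2 + s * (1 - s) * M)
      = 2 / 3 * (a ^ 2 - a * b + b ^ 2) + M / 6 := by
    have hd : ∀ s ∈ Set.uIcc (0 : ℝ) 1, HasDerivAt
        (fun s => (2 * b ^ 2) * s + (M - 4 * b * (a + b)) / 2 * s ^ 2
          + (2 * (a + b) ^ 2 - M) / 3 * s ^ 3)
        (2 * (s * a - (1 - s) * b) ^ 2 + s * (1 - s) * M) s := by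
      intro s _
      refine HasDerivAt.congr_deriv ((((hasDerivAt_id' s).const_mul _).fun_add
        ((hasDerivAt_pow 2 s).const_mul _)).fun_add ((hasDerivAt_pow 3 s).const_mul _)) ?_
      push_cast
      ring
    rw [intervalIntegral.integral_eq_sub_of_hasDerivAt hd
      (Continuous.intervalIntegrable (by fun_prop) _ _)]
    ring
  -- The right side exceeds the left by `(M + 4ab) / 2`, which is nonnegative by `h4`.
  refine lt_of_lt_of_le ?_ (show 2 / 3 * (a ^ 2 - a * b + b ^ 2) + M / 6 ≤ _ by nlinarith)
  rw [← hint]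
  obtain ⟨s, hs, hpos⟩ := quadratic_pos h
  refine intervalIntegral.integral_lt_integral_of_continuousOn_of_le_of_exists_lt one_pos
    (by fun_prop) (by fun_prop) ?_ ⟨s, Set.Ioc_subset_Icc_self hs, ?_⟩
  · intro r hr
    refine mul_le_of_le_one_right (quadratic_nonneg a b hM (Set.Ioc_subset_Icc_self hr)) ?_
    exact Real.exp_le_one_iff.2 (neg_nonpos.2 (mul_nonneg ht.le hr.1.le))
  · refine mul_lt_of_lt_one_right hpos ?_
    rw [Real.exp_lt_one_iff]
    exact neg_lt_zero.2 (mul_pos ht hs.1)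

/-! ### Evaluation of the curvature on a pair of vectors -/

theorem lowered_riemann {p : Fin 4 → ℝ} (hp : 0 < p 3) (l k i j : Fin 4) :
    ∑ m, heisenbergSoliton.gram p m l * heisenbergSoliton.riemann m k i j p
      = heisCurvature p l k i j := by
  rcases lt_trichotomy i j with h | rfl | h
  · exact lowered_riemann_of_lt hp l k i j h
  · have h1 : ∀ m, heisenbergSoliton.riemann m k i i p = 0 := fun m =>
      self_eq_neg.1 (heisenbergSoliton.riemann_swap m k i i p)
    have h2 : heisCurvature p l k i i = 0 := self_eq_neg.1 (heisCurvature_swap p l k i i)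
    simp [h1, h2]
  · rw [heisCurvature_swap, ← lowered_riemann_of_lt hp l k j i h, ← Finset.sum_neg_distrib]
    refine Finset.sum_congr rfl fun m _ => ?_
    rw [heisenbergSoliton.riemann_swap m k i j p]
    ring

theorem inner_curvature_eq_sum {p : Fin 4 → ℝ} (hp : 0 < p 3) (u v : Fin 4 → ℝ) :
    heisenbergSoliton.inner p (heisenbergSoliton.curvature p u v v) u
      = ∑ l, ∑ k, ∑ i, ∑ j, heisCurvature p l k i j * u l * v k * u i * v j := by
  simp only [← lowered_riemann hp, ChartMetric.inner, ChartMetric.curvature, Finset.sum_mul,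
    Finset.mul_sum]
  rw [Finset.sum_comm]
  refine Finset.sum_congr rfl fun l _ => ?_
  rw [Finset.sum_comm]
  refine Finset.sum_congr rfl fun k _ => ?_
  rw [Finset.sum_comm]
  refine Finset.sum_congr rfl fun i _ => ?_
  rw [Finset.sum_comm]
  refine Finset.sum_congr rfl fun j _ => ?_
  refine Finset.sum_congr rfl fun m _ => ?_
  ring

theorem sum_mul_bilinear (α β : Fin 4 → Fin 4 → ℝ) (u v : Fin 4 → ℝ) :
    ∑ l, ∑ k, ∑ i, ∑ j, α l k * β i j * u l * v k * u i * v j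
      = (∑ i, ∑ j, α i j * u i * v j) * ∑ i, ∑ j, β i j * u i * v j := by
  rw [Finset.sum_mul]
  refine Finset.sum_congr rfl fun l _ => ?_
  rw [Finset.sum_mul]
  refine Finset.sum_congr rfl fun k _ => ?_
  rw [Finset.mul_sum]
  refine Finset.sum_congr rfl fun i _ => ?_
  rw [Finset.mul_sum]
  refine Finset.sum_congr rfl fun j _ => ?_
  ring

theorem heisFormA_apply (p u v : Fin 4 → ℝ) : ∑ i, ∑ j, heisFormA p i j * u i * v j
    = (p 0 * u 1 - u 2) * v 3 - (p 0 * v 1 - v 2) * u 3 := by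
  simp only [heisFormA, sum_wedgeMatrix]
  simp [Fin.sum_univ_four, coframeZeta, coframePhi]
  ring

theorem heisFormB_apply (p u v : Fin 4 → ℝ) : ∑ i, ∑ j, heisFormB p i j * u i * v j
    = p 3 * (u 0 * v 1 - v 0 * u 1) := by
  simp only [heisFormB, mul_assoc, ← Finset.mul_sum]
  simp only [← mul_assoc, sum_wedgeMatrix]
  simp [Fin.sum_univ_four, coframeSigma, coframeRho]

theorem heisFormC_apply (p u v : Fin 4 → ℝ) : ∑ i, ∑ j, heisFormC p i j * u i * v j
    = (u 0 * (p 0 * v 1 - v 2) - v 0 * (p 0 * u 1 - u 2))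
      - (u 1 * v 3 - v 1 * u 3) / heisF 1 (p 3) := by
  simp [heisFormC, wedgeMatrix, Fin.sum_univ_four, coframeSigma, coframeRho, coframeZeta,
    coframePhi]
  ring

theorem heisFormD_apply (p u v : Fin 4 → ℝ) : ∑ i, ∑ j, heisFormD p i j * u i * v j
    = (u 1 * (p 0 * v 1 - v 2) - v 1 * (p 0 * u 1 - u 2))
      + (u 0 * v 3 - v 0 * u 3) / heisF 1 (p 3) := by
  simp [heisFormD, wedgeMatrix, Fin.sum_univ_four, coframeSigma, coframeRho, coframeZeta,
    coframePhi]
  ring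

theorem inner_curvature {p : Fin 4 → ℝ} (hp : 0 < p 3) (u v : Fin 4 → ℝ) {a b c d : ℝ}
    (ha : ∑ i, ∑ j, heisFormA p i j * u i * v j = a)
    (hb : ∑ i, ∑ j, heisFormB p i j * u i * v j = b)
    (hc : ∑ i, ∑ j, heisFormC p i j * u i * v j = c)
    (hd : ∑ i, ∑ j, heisFormD p i j * u i * v j = d) :
    heisenbergSoliton.inner p (heisenbergSoliton.curvature p u v v) u
      = -heisFDeriv₂ (p 3) / 2 * a ^ 2 - heisF 1 (p 3) / p 3 ^ 2 * b ^ 2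
        + (heisF 1 (p 3) - p 3 * heisFDeriv (p 3)) / (4 * p 3 ^ 2) *
          (-4 * a * b + p 3 * heisF 1 (p 3) * (c ^ 2 + d ^ 2)) := by
  set K := -heisFDeriv₂ (p 3) / 2
  set L := heisF 1 (p 3) / p 3 ^ 2
  set N := (heisF 1 (p 3) - p 3 * heisFDeriv (p 3)) / (4 * p 3 ^ 2)
  set W := p 3 * heisF 1 (p 3)
  have key : ∀ l k i j, heisCurvature p l k i j * u l * v k * u i * v j =
      K * (heisFormA p l k * heisFormA p i j * u l * v k * u i * v j)
      - L * (heisFormB p l k * heisFormB p i j * u l * v k * u i * v j)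
      - 2 * N * (heisFormA p l k * heisFormB p i j * u l * v k * u i * v j)
      - 2 * N * (heisFormB p l k * heisFormA p i j * u l * v k * u i * v j)
      + N * W * (heisFormC p l k * heisFormC p i j * u l * v k * u i * v j)
      + N * W * (heisFormD p l k * heisFormD p i j * u l * v k * u i * v j) := by
    intro l k i j
    simp only [heisCurvature]
    ring
  rw [inner_curvature_eq_sum hp]
  simp only [key, Finset.sum_add_distrib, Finset.sum_sub_distrib, ← Finset.mul_sum,
    sum_mul_bilinear, ha, hb, hc, hd]
  ring

/-- The left side is the squared norm of `u ∧ v`. Expanding `c² + d²` leaves cross terms, which the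
Plücker relation for the decomposable bivector `u ∧ v` turns into the correction `2ab`. -/
theorem gram_det {p : Fin 4 → ℝ} (hp : 0 < p 3) (u v : Fin 4 → ℝ) {a b c d : ℝ}
    (ha : ∑ i, ∑ j, heisFormA p i j * u i * v j = a)
    (hb : ∑ i, ∑ j, heisFormB p i j * u i * v j = b)
    (hc : ∑ i, ∑ j, heisFormC p i j * u i * v j = c)
    (hd : ∑ i, ∑ j, heisFormD p i j * u i * v j = d) :
    heisenbergSoliton.inner p u u * heisenbergSoliton.inner p v v
        - heisenbergSoliton.inner p u v ^ 2
      = a ^ 2 + b ^ 2 + p 3 * heisF 1 (p 3) * (c ^ 2 + d ^ 2) + 2 * a * b := by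
  have hF := (heisF_one_pos hp).ne'
  have hg : heisenbergSoliton.gram = heisGram := rfl
  rw [← ha, ← hb, ← hc, ← hd, heisFormA_apply, heisFormB_apply, heisFormC_apply, heisFormD_apply]
  simp only [ChartMetric.inner, hg, heisGram_eq, Fin.sum_univ_four]
  simp
  field_simp
  ring

/-! ### Strict Cauchy–Schwarz for a chart metric -/

theorem ChartMetric.inner_eq_dotProduct {ι : Type} [Fintype ι] [DecidableEq ι]
    (g : ChartMetric ι) (p u v : ι → ℝ) : g.inner p u v = u ⬝ᵥ (g.gram p).mulVec v := by
  simp only [inner, dotProduct, Matrix.mulVec, Finset.mul_sum]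
  refine Finset.sum_congr rfl fun i _ => Finset.sum_congr rfl fun j _ => ?_
  ring

theorem ChartMetric.inner_comm {ι : Type} [Fintype ι] [DecidableEq ι] (g : ChartMetric ι)
    {p : ι → ℝ} (hp : p ∈ g.domain) (u v : ι → ℝ) : g.inner p u v = g.inner p v u := by
  have hsymm : ∀ i j, g.gram p i j = g.gram p j i := fun i j => by
    simpa using (g.posDef p hp).isHermitian.apply j i
  rw [inner, inner, Finset.sum_comm]
  refine Finset.sum_congr rfl fun i _ => Finset.sum_congr rfl fun j _ => ?_
  rw [hsymm]
  ring

theorem ChartMetric.gram_det_pos {ι : Type} [Fintype ι] [DecidableEq ι] (g : ChartMetric ι)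
    {p : ι → ℝ} (hp : p ∈ g.domain) {u v : ι → ℝ} (h : LinearIndependent ℝ ![u, v]) :
    0 < g.inner p u u * g.inner p v v - g.inner p u v ^ 2 := by
  have hpos : ∀ w : ι → ℝ, w ≠ 0 → 0 < g.inner p w w := by
    intro w hw
    rw [inner_eq_dotProduct]
    simpa using (g.posDef p hp).dotProduct_mulVec_pos hw
  have hv : v ≠ 0 := by simpa using h.ne_zero 1
  -- The squared norm of this vector, a multiple of the component of `u` orthogonal to `v`, is `g(v,
  -- v)` times the Gram determinant.
  have hw : g.inner p v v • u - g.inner p u v • v ≠ 0 := by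
    intro h0
    have := LinearIndependent.pair_iff.1 h (g.inner p v v) (-g.inner p u v)
      (by rw [neg_smul, ← sub_eq_add_neg, h0])
    exact (hpos v hv).ne' this.1
  have key : ∀ a b : ℝ, g.inner p (a • u - b • v) (a • u - b • v)
      = a ^ 2 * g.inner p u u - 2 * a * b * g.inner p u v + b ^ 2 * g.inner p v v := by
    intro a b
    have hc := g.inner_comm hp u v
    simp only [inner_eq_dotProduct] at hc ⊢
    simp only [Matrix.mulVec_sub, Matrix.mulVec_smul, sub_dotProduct, dotProduct_sub,
      smul_dotProduct, dotProduct_smul, smul_eq_mul]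
    linear_combination (-a * b) * (-hc)
  have h1 := hpos _ hw
  rw [key] at h1
  refine pos_of_mul_pos_right (a := g.inner p v v) ?_ (hpos v hv).le
  linarith

/-! ### Bounds on the sectional curvature -/

/-- Coefficientwise, `F''/2`, `F/t²` and `-(F - tF')/(4t²)` are the moments of `2s²`, `2(1-s)²` and
`s(1-s)` against `e^{-ts}`. -/
theorem integral_curvature {t : ℝ} (ht : 0 < t) (a b M : ℝ) :
    ∫ s in (0 : ℝ)..1, (2 * (s * a - (1 - s) * b) ^ 2 + s * (1 - s) * M) * Real.exp (-(t * s))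
      = heisFDeriv₂ t / 2 * a ^ 2 + heisF 1 t / t ^ 2 * b ^ 2
        - (heisF 1 t - t * heisFDeriv t) / (4 * t ^ 2) * (-4 * a * b + M) := by
  have h := integral_quadratic_mul_exp ht (2 * b ^ 2) (M - 4 * b * (a + b))
    (2 * (a + b) ^ 2 - M)
  rw [show (fun s : ℝ => (2 * (s * a - (1 - s) * b) ^ 2 + s * (1 - s) * M) * Real.exp (-(t * s)))
    = fun s => (2 * b ^ 2 + (M - 4 * b * (a + b)) * s + (2 * (a + b) ^ 2 - M) * s ^ 2)
      * Real.exp (-(t * s)) from funext fun s => by ring, h, heisF_one_eq, heisFDeriv, heisFDeriv₂]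
  field_simp
  ring

theorem sec_eq_integral {p : Fin 4 → ℝ} (hp : 0 < p 3) (u v : Fin 4 → ℝ) :
    ∃ a b M : ℝ, 0 ≤ M ∧ 0 ≤ M + 4 * a * b ∧
      heisenbergSoliton.inner p u u * heisenbergSoliton.inner p v v
        - heisenbergSoliton.inner p u v ^ 2 = a ^ 2 + b ^ 2 + M + 2 * a * b ∧
      heisenbergSoliton.inner p (heisenbergSoliton.curvature p u v v) u
        = -∫ s in (0 : ℝ)..1,
          (2 * (s * a - (1 - s) * b) ^ 2 + s * (1 - s) * M) * Real.exp (-(p 3 * s)) := by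
  have hF := heisF_one_pos hp
  refine ⟨_, _, p 3 * heisF 1 (p 3) * (_ ^ 2 + _ ^ 2), ?_, ?_, gram_det hp u v rfl rfl rfl rfl, ?_⟩
  · positivity
  · rw [heisFormA_apply, heisFormB_apply, heisFormC_apply, heisFormD_apply]
    -- Flipping the relative signs in `c` and `d` gives another sum of squares; by the Plücker
    -- relation it equals `M + 4ab`.
    have : 0 ≤ p 3 * heisF 1 (p 3) *
        (((u 0 * (p 0 * v 1 - v 2) - v 0 * (p 0 * u 1 - u 2))
            + (u 1 * v 3 - v 1 * u 3) / heisF 1 (p 3)) ^ 2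
          + ((u 1 * (p 0 * v 1 - v 2) - v 1 * (p 0 * u 1 - u 2))
            - (u 0 * v 3 - v 0 * u 3) / heisF 1 (p 3)) ^ 2) := by positivity
    convert this using 1
    field_simp
    ring
  · rw [integral_curvature hp, inner_curvature hp u v rfl rfl rfl rfl]
    ring

theorem sec_heisenbergSoliton_mem_Ioo {p : Fin 4 → ℝ} (hp : p ∈ heisenbergSoliton.domain)
    {u v : Fin 4 → ℝ} (h : LinearIndependent ℝ ![u, v]) :
    heisenbergSoliton.sec p u v ∈ Set.Ioo (-2 / 3 : ℝ) 0 := by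
  have hp' : 0 < p 3 := hp
  have hdet := heisenbergSoliton.gram_det_pos hp h
  obtain ⟨a, b, M, hM, h4, h1, h2⟩ := sec_eq_integral hp' u v
  rw [ChartMetric.sec, h2, Set.mem_Ioo, lt_div_iff₀ hdet, div_lt_iff₀ hdet, h1]
  rw [h1] at hdet
  have hlt := integral_curvature_lt hp' hM h4 hdet
  have hpos := integral_curvature_pos (t := p 3) hM hdet
  constructor <;> linarith

/-! ### Sharpness of both bounds -/

/-- For the plane of `∂_x, ∂_y` at `x = 0` one has `a = c = d = 0` and `b = t`, so only the `b²`
term survives. -/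
theorem neg_heisF_div_mem_secValues {t : ℝ} (ht : 0 < t) :
    -(heisF 1 t / t ^ 2) ∈ heisenbergSoliton.secValues := by
  have hp : 0 < (![0, 0, 0, t] : Fin 4 → ℝ) 3 := ht
  refine ⟨![0, 0, 0, t], hp, ![1, 0, 0, 0], ![0, 1, 0, 0], ?_, ?_⟩
  · rw [LinearIndependent.pair_iff]
    intro r s hrs
    exact ⟨by simpa using congrFun hrs 0, by simpa using congrFun hrs 1⟩
  · rw [ChartMetric.sec, gram_det hp _ _ rfl rfl rfl rfl, inner_curvature hp _ _ rfl rfl rfl rfl,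
      heisFormA_apply, heisFormB_apply, heisFormC_apply, heisFormD_apply]
    simp
    field_simp

theorem heisF_div_sq_le {t : ℝ} (ht : 1 ≤ t) : heisF 1 t / t ^ 2 ≤ 6 / t := by
  have h0 : 0 < t := by linarith
  rw [heisF_one_eq, div_le_div_iff₀ (by positivity) h0]
  have := Real.exp_pos (-t)
  have h1 : 4 / t * (1 - t + t ^ 2 / 2 - Real.exp (-t)) * t
      = 4 * (1 - t + t ^ 2 / 2 - Real.exp (-t)) := by
    field_simp
  rw [h1]
  nlinarith

/-- Here `F/t² = ∫ 2(1-s)² e^{-ts} ds`, and `e^{-ts} ≥ 1 - ts` gives `2/3 - t/6`, stronger than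
required. -/
theorem le_heisF_div_sq {t : ℝ} (ht : 0 < t) : 2 / 3 - t / 2 ≤ heisF 1 t / t ^ 2 := by
  have h := integral_curvature ht 0 1 0
  have hle : ∫ s in (0 : ℝ)..1, 2 * (1 - s) ^ 2 * (1 - t * s) ≤ ∫ s in (0 : ℝ)..1,
      (2 * (s * 0 - (1 - s) * 1) ^ 2 + s * (1 - s) * 0) * Real.exp (-(t * s)) := by
    refine intervalIntegral.integral_mono_on zero_le_one
      (Continuous.intervalIntegrable (by fun_prop) _ _)
      (Continuous.intervalIntegrable (by fun_prop) _ _) fun s _ => ?_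
    have h1 : 1 - t * s ≤ Real.exp (-(t * s)) := by linarith [Real.add_one_le_exp (-(t * s))]
    calc 2 * (1 - s) ^ 2 * (1 - t * s) ≤ 2 * (1 - s) ^ 2 * Real.exp (-(t * s)) := by gcongr
      _ = _ := by ring
  have hint : ∫ s in (0 : ℝ)..1, 2 * (1 - s) ^ 2 * (1 - t * s) = 2 / 3 - t / 6 := by
    have hd : ∀ s ∈ Set.uIcc (0 : ℝ) 1, HasDerivAt
        (fun s => 2 * s + (-2 - t) * s ^ 2 + (2 + 4 * t) / 3 * s ^ 3 + (-t / 2) * s ^ 4)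
        (2 * (1 - s) ^ 2 * (1 - t * s)) s := by
      intro s _
      refine HasDerivAt.congr_deriv (((((hasDerivAt_id' s).const_mul _).fun_add
        ((hasDerivAt_pow 2 s).const_mul _)).fun_add ((hasDerivAt_pow 3 s).const_mul _)).fun_add
        ((hasDerivAt_pow 4 s).const_mul _)) ?_
      push_cast
      ring
    rw [intervalIntegral.integral_eq_sub_of_hasDerivAt hd
      (Continuous.intervalIntegrable (by fun_prop) _ _)]
    ring
  rw [hint, h] at hle
  linarith

theorem mainTheorem5 :
    (∀ p ∈ heisenbergSoliton.domain, ∀ u v : Fin 4 → ℝ, LinearIndependent ℝ ![u, v] →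
      -2 / 3 < heisenbergSoliton.sec p u v ∧ heisenbergSoliton.sec p u v < 0) ∧
    IsGLB heisenbergSoliton.secValues (-2 / 3) ∧
    IsLUB heisenbergSoliton.secValues 0 := by
  refine ⟨fun p hp u v h => sec_heisenbergSoliton_mem_Ioo hp h, ⟨?_, ?_⟩, ⟨?_, ?_⟩⟩
  · rintro κ ⟨p, hp, u, v, h, rfl⟩
    exact (sec_heisenbergSoliton_mem_Ioo hp h).1.le
  · intro κ hκ
    refine le_of_forall_pos_le_add fun ε hε => ?_
    have h1 := hκ (neg_heisF_div_mem_secValues (t := 2 * ε) (by positivity))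
    have h2 := le_heisF_div_sq (t := 2 * ε) (by positivity)
    linarith
  · rintro κ ⟨p, hp, u, v, h, rfl⟩
    exact (sec_heisenbergSoliton_mem_Ioo hp h).2.le
  · intro κ hκ
    refine le_of_forall_pos_le_add fun ε hε => ?_
    -- The choice `t ≥ 6/ε` makes the bound `6/t` at most `ε`, while `t ≥ 1` is what
    -- `heisF_div_sq_le` requires.
    have ht : 1 ≤ max 1 (6 / ε) := le_max_left _ _
    have h1 := hκ (neg_heisF_div_mem_secValues (t := max 1 (6 / ε)) (by linarith))
    have h2 := heisF_div_sq_le ht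
    have h3 : 6 / max 1 (6 / ε) ≤ ε := by
      rw [div_le_comm₀ (by linarith) hε]
      exact le_max_right _ _
    linarith
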